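/- Let $d\in\mathbb N$ and let $F^2_d$ be the full Fock space over $\mathbb C^d$, with orthonormal basis $(e_\alpha)$ indexed by the words $\alpha$ in the letters $1,\dots,d$, and left creation operators $L_k e_\alpha=e_{k\alpha}$, $1\le k\le d$. Inner products are conjugate-linear in the first argument. For $n\ge 1$ let $\mathbb B^d_n$ be the set of $d$-tuples $Z=(Z_1,\dots,Z_d)$ of complex $n\times n$ matrices whose row $[Z_1\ \cdots\ Z_d]:\mathbb C^{n}\otimes\mathbb C^d\to\mathbb C^n$ has operator norm $<1$, and let $\mathbb B^d_{\mathbb N}=\bigsqcup_{n\ge1}\mathbb B^d_n$. For a word $\alpha=i_1\cdots i_m$ write $Z^\alpha=Z_{i_1}\cdots Z_{i_m}$. Each $x=\sum_\alpha x_\alpha e_\alpha\in F^2_d$ is identified with the function $x(Z)=\sum_\alpha x_\alpha Z^\alpha$ on $\mathbb B^d_{\mathbb N}$. For $Z\in\mathbb B^d_n$ let $K_Z:\mathbb C^{n\times n}\to F^2_d$ be the linear map with $$K_Z(yv^*)=\sum_\alpha\langle Z^\alpha v,y\rangle e_\alpha\qquad(y,v\in\mathbb C^n).$$ A free function on $\mathbb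 B^d_{\mathbb N}$ is a function $H$ that assigns to each $Z\in\mathbb B^d_n$ a matrix $H(Z)\in\mathbb C^{n\times n}$, for every $n\ge1$, such that $H(Z)X=XH(W)$ whenever $Z\in\mathbb B^d_n$, $W\in\mathbb B^d_m$, $X\in\mathbb C^{n\times m}$ and $Z_kX=XW_k$ for all $1\le k\le d$. Let $T:\operatorname{dom}T\subseteq F^2_d\to F^2_d$ be a closed, densely defined linear operator that is affiliated to the right free shift: for every $1\le k\le d$ and $x\in\operatorname{dom}T$ one has $L_kx\in\operatorname{dom}T$ and $TL_kx=L_kTx$. Suppose that the linear span of the ranges $\operatorname{ran}K_Z$, $Z\in\mathbb B^d_{\mathbb N}$, is contained in $\operatorname{dom}T^*$. Then $T$ acts as right multiplication by a free function: there is a free function $T(\cdot)$ on $\mathbb B^d_{\mathbb N}$ such that $$(Tx)(Z)=x(Z)\,T(Z)\qquad\text{for all }x\in\operatorname{dom}T\text{ and all }Z\in\mathbb B^d_{\mathbb N}.$$ -/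

import Mathlib

namespace FreeHardy

open scoped Matrix

/-- The full Fock space `F²_d`, in its canonical orthonormal basis `e_α` indexed by the words `α`
of the free monoid on `d` letters: square-summable families of coefficients. -/
abbrev Fock (d : ℕ) : Type := lp (fun _ : FreeMonoid (Fin d) => ℂ) 2

/-- Coefficients of `e_k ⊗ f`: the coefficient at the word `kβ` is that of `f` at `β`, and the
coefficients at all other words vanish. -/
def shiftCoeff {d : ℕ} (k : Fin d) (f : FreeMonoid (Fin d) → ℂ) : List (Fin d) → ℂ
  | [] => 0
  | j :: β => if j = k then f (FreeMonoid.ofList β) else 0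

theorem memlp_shiftCoeff {d : ℕ} (k : Fin d) (f : Fock d) :
    Memℓp (fun α : FreeMonoid (Fin d) => shiftCoeff k f α.toList) 2 := by
  have hf : Summable fun β : FreeMonoid (Fin d) => ‖f β‖ ^ (2 : ℝ) := by
    have := (lp.memℓp f).summable (by norm_num)
    simpa using this
  refine memℓp_gen ?_
  have hinj : Function.Injective (fun β : FreeMonoid (Fin d) => FreeMonoid.of k * β) :=
    fun a b h => mul_left_cancel h
  have h0 : ∀ α : FreeMonoid (Fin d), α ∉ Set.range (fun β => FreeMonoid.of k * β) →
      ‖shiftCoeff k f α.toList‖ ^ (2 : ENNReal).toReal = 0 := by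
    intro α hα
    have : shiftCoeff k f α.toList = 0 := by
      rcases h : α.toList with _ | ⟨j, β⟩
      · rfl
      · simp only [shiftCoeff]
        rw [if_neg]
        rintro rfl
        exact hα ⟨FreeMonoid.ofList β, FreeMonoid.toList.injective (by simp [h])⟩
    simp [this]
  refine (hinj.summable_iff h0).1 ?_
  convert hf using 2 with β
  simp [shiftCoeff]

/-- The left creation operator `L_k f = e_k ⊗ f` on the Fock space. -/
def leftCreation {d : ℕ} (k : Fin d) : Fock d →ₗ[ℂ] Fock d where
  toFun f := ⟨fun α => shiftCoeff k f α.toList, memlp_shiftCoeff k f⟩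
  map_add' f g := by
    ext α
    change shiftCoeff k _ α.toList = shiftCoeff k _ α.toList + shiftCoeff k _ α.toList
    rcases α.toList with _ | ⟨j, β⟩
    · simp [shiftCoeff]
    · by_cases h : j = k <;> simp [shiftCoeff, h]
  map_smul' c f := by
    ext α
    change shiftCoeff k _ α.toList = c * shiftCoeff k _ α.toList
    rcases α.toList with _ | ⟨j, β⟩
    · simp [shiftCoeff]
    · by_cases h : j = k <;> simp [shiftCoeff, h]

/-- `T ∼ R^∞_d`: the linear operator `T` with domain in `F²_d` is closed, densely defined, and
affiliated to the right free shift, i.e. `L_k dom T ⊆ dom T` and `T L_k x = L_k T x` for every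
`k` and every `x ∈ dom T`. -/
structure IsRightAffiliated {d : ℕ} (T : Fock d →ₗ.[ℂ] Fock d) : Prop where
  isClosed : T.IsClosed
  dense_domain : Dense (T.domain : Set (Fock d))
  comm : ∀ (k : Fin d) (x : T.domain),
    ∃ h : leftCreation k (x : Fock d) ∈ T.domain, T ⟨leftCreation k x, h⟩ = leftCreation k (T x)

/-- The `n × nd` block row matrix `[Z_1, …, Z_d]`. -/
def rowMatrix {d n : ℕ} (Z : Fin d → Matrix (Fin n) (Fin n) ℂ) :
    Matrix (Fin n) (Fin d × Fin n) ℂ :=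
  Matrix.of fun i p => Z p.1 i p.2

section
open scoped Matrix.Norms.L2Operator

/-- The level `n ≥ 1` of the open unit ball of non-commuting variables: `d`-tuples of complex
`n × n` matrices whose block row has Euclidean operator norm less than one. There is no level
`0`. -/
def ncBall (d n : ℕ) : Set (Fin d → Matrix (Fin n) (Fin n) ℂ) :=
  {Z | 0 < n ∧ ‖rowMatrix Z‖ < 1}

end

/-- `Z^α = Z_{i_1} ⋯ Z_{i_m}` for the word `α = i_1 ⋯ i_m`. -/
noncomputable def wordPow {d n : ℕ} (Z : Fin d → Matrix (Fin n) (Fin n) ℂ)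
    (α : FreeMonoid (Fin d)) : Matrix (Fin n) (Fin n) ℂ :=
  FreeMonoid.lift Z α

/-- A free (non-commutative) function on the ball: it respects the grading (built into its type)
and intertwinings. -/
structure FreeFunction (d : ℕ) where
  toFun : ∀ {n : ℕ}, ncBall d n → Matrix (Fin n) (Fin n) ℂ
  intertwines : ∀ {n m : ℕ} (Z : ncBall d n) (W : ncBall d m) (X : Matrix (Fin n) (Fin m) ℂ),
    (∀ k, Z.1 k * X = X * W.1 k) → toFun Z * X = X * toFun W

/-- The value `x(Z) = ∑_α x_α Z^α` at a point `Z` of the ball of the element of the free Hardy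
space that corresponds to `x ∈ F²_d`. The series converges, see `summable_eval`. -/
noncomputable def eval {d n : ℕ} (x : Fock d) (Z : ncBall d n) : Matrix (Fin n) (Fin n) ℂ :=
  Matrix.of fun i j => ∑' α : FreeMonoid (Fin d), x α * wordPow Z.1 α i j

section
open scoped Matrix.Norms.L2Operator

/-- The sum of the squared moduli of the entries of a vector. -/
noncomputable def sqSum {n : ℕ} (y : Fin n → ℂ) : ℝ := ∑ i, ‖y i‖ ^ 2

theorem sqSum_nonneg {n : ℕ} (y : Fin n → ℂ) : 0 ≤ sqSum y :=
  Finset.sum_nonneg fun _ _ => by positivity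

theorem sum_sqSum_le {d n : ℕ} (Z : Fin d → Matrix (Fin n) (Fin n) ℂ) (y : Fin n → ℂ) :
    ∑ k, sqSum ((Z k)ᴴ *ᵥ y) ≤ ‖rowMatrix Z‖ ^ 2 * sqSum y := by
  have h := Matrix.l2_opNorm_mulVec (rowMatrix Z)ᴴ (WithLp.toLp 2 y)
  rw [Matrix.l2_opNorm_conjTranspose] at h
  have h2 := pow_le_pow_left₀ (norm_nonneg _) h 2
  rw [mul_pow, EuclideanSpace.norm_sq_eq, EuclideanSpace.norm_sq_eq] at h2
  refine le_trans (le_of_eq ?_) h2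
  rw [Fintype.sum_prod_type]
  rfl

theorem wordPow_of_mul {d n : ℕ} (Z : Fin d → Matrix (Fin n) (Fin n) ℂ) (k : Fin d)
    (β : FreeMonoid (Fin d)) : wordPow Z (FreeMonoid.of k * β) = Z k * wordPow Z β := by
  simp [wordPow]

theorem sum_words_le {d n : ℕ} {Z : Fin d → Matrix (Fin n) (Fin n) ℂ} (hZ : ‖rowMatrix Z‖ < 1)
    (N : ℕ) (s : Finset (FreeMonoid (Fin d))) (hs : ∀ α ∈ s, α.length < N) (y : Fin n → ℂ) :
    ∑ α ∈ s, sqSum ((wordPow Z α)ᴴ *ᵥ y) ≤ (1 - ‖rowMatrix Z‖ ^ 2)⁻¹ * sqSum y := by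
  classical
  have hr : 0 < 1 - ‖rowMatrix Z‖ ^ 2 := by nlinarith [norm_nonneg (rowMatrix Z)]
  induction N generalizing s y with
  | zero =>
    have : s = ∅ := Finset.eq_empty_of_forall_notMem fun α h => by simpa using hs α h
    subst this
    simpa using mul_nonneg (inv_nonneg.2 hr.le) (sqSum_nonneg y)
  | succ N ih =>
    let P : Fin d → Finset (FreeMonoid (Fin d)) := fun k =>
      s.preimage (fun β => FreeMonoid.of k * β) (fun a _ b _ h => mul_left_cancel h)
    have hsub : s ⊆ insert 1 (Finset.univ.biUnion fun k =>
        (P k).image fun β => FreeMonoid.of k * β) := by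
      intro α hα
      induction α using FreeMonoid.casesOn with
      | one => simp
      | of_mul k β =>
        refine Finset.mem_insert_of_mem (Finset.mem_biUnion.2 ⟨k, Finset.mem_univ _, ?_⟩)
        exact Finset.mem_image_of_mem _ (Finset.mem_preimage.2 hα)
    have hP : ∀ k, ∑ β ∈ P k, sqSum ((wordPow Z (FreeMonoid.of k * β))ᴴ *ᵥ y) ≤
        (1 - ‖rowMatrix Z‖ ^ 2)⁻¹ * sqSum ((Z k)ᴴ *ᵥ y) := by
      intro k
      have := ih (P k) (fun β hβ => by
        have := hs _ (Finset.mem_preimage.1 hβ)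
        rw [FreeMonoid.length_mul, FreeMonoid.length_of] at this
        omega) ((Z k)ᴴ *ᵥ y)
      refine le_trans (le_of_eq (Finset.sum_congr rfl fun β _ => ?_)) this
      rw [wordPow_of_mul, Matrix.conjTranspose_mul, Matrix.mulVec_mulVec]
    have hnn : ∀ α, 0 ≤ sqSum ((wordPow Z α)ᴴ *ᵥ y) := fun α => sqSum_nonneg _
    have h1 : sqSum ((wordPow Z 1)ᴴ *ᵥ y) = sqSum y := by simp [wordPow]
    calc ∑ α ∈ s, sqSum ((wordPow Z α)ᴴ *ᵥ y)
        ≤ ∑ α ∈ insert 1 (Finset.univ.biUnion fun k =>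
            (P k).image fun β => FreeMonoid.of k * β), sqSum ((wordPow Z α)ᴴ *ᵥ y) :=
          Finset.sum_le_sum_of_subset_of_nonneg hsub fun α _ _ => hnn α
      _ ≤ sqSum y + ∑ α ∈ Finset.univ.biUnion fun k =>
            (P k).image fun β => FreeMonoid.of k * β, sqSum ((wordPow Z α)ᴴ *ᵥ y) := by
          rw [← h1]
          by_cases hmem : (1 : FreeMonoid (Fin d)) ∈ Finset.univ.biUnion fun k =>
            (P k).image fun β => FreeMonoid.of k * β
          · rw [Finset.insert_eq_of_mem hmem]
            linarith [hnn 1]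
          · rw [Finset.sum_insert hmem]
      _ ≤ sqSum y + ∑ k, ∑ α ∈ (P k).image fun β => FreeMonoid.of k * β,
            sqSum ((wordPow Z α)ᴴ *ᵥ y) := by
          gcongr
          rw [Finset.sum_biUnion]
          intro k _ l _ hkl
          rw [Function.onFun, Finset.disjoint_left]
          intro α h h'
          obtain ⟨a, -, rfl⟩ := Finset.mem_image.1 h
          obtain ⟨b, -, hb⟩ := Finset.mem_image.1 h'
          have := congrArg FreeMonoid.toList hb
          simp at this
          exact hkl this.1.symm
      _ ≤ sqSum y + ∑ k, (1 - ‖rowMatrix Z‖ ^ 2)⁻¹ * sqSum ((Z k)ᴴ *ᵥ y) := by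
          gcongr with k
          rw [Finset.sum_image fun a _ b _ h => mul_left_cancel h]
          exact hP k
      _ ≤ sqSum y + (1 - ‖rowMatrix Z‖ ^ 2)⁻¹ * (‖rowMatrix Z‖ ^ 2 * sqSum y) := by
          rw [← Finset.mul_sum]
          gcongr
          exact sum_sqSum_le Z y
      _ = (1 - ‖rowMatrix Z‖ ^ 2)⁻¹ * sqSum y := by
          field_simp
          ring

theorem memlp_mulVec {d n : ℕ} (Z : ncBall d n) (y : Fin n → ℂ) (j : Fin n) :
    Memℓp (fun α : FreeMonoid (Fin d) => ((wordPow Z.1 α)ᴴ *ᵥ y) j) 2 := by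
  refine memℓp_gen' (C := (1 - ‖rowMatrix Z.1‖ ^ 2)⁻¹ * sqSum y) fun s => ?_
  refine le_trans (Finset.sum_le_sum fun α _ => ?_)
    (sum_words_le Z.2.2 (s.sup FreeMonoid.length + 1) s
      (fun α h => Nat.lt_succ_of_le (Finset.le_sup (f := FreeMonoid.length) h)) y)
  have : ‖((wordPow Z.1 α)ᴴ *ᵥ y) j‖ ^ 2 ≤ sqSum ((wordPow Z.1 α)ᴴ *ᵥ y) :=
    Finset.single_le_sum (f := fun i => ‖((wordPow Z.1 α)ᴴ *ᵥ y) i‖ ^ 2)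
      (fun i _ => by positivity) (Finset.mem_univ j)
  simpa using this

end

theorem memlp_kernel {d n : ℕ} (Z : ncBall d n) (A : Matrix (Fin n) (Fin n) ℂ) :
    Memℓp (fun α : FreeMonoid (Fin d) => ((wordPow Z.1 α)ᴴ * A).trace) 2 := by
  have := Memℓp.finsetSum (p := 2) (E := fun _ : FreeMonoid (Fin d) => ℂ) Finset.univ
    (f := fun j α => ((wordPow Z.1 α)ᴴ *ᵥ fun i => A i j) j)
    (fun j _ => memlp_mulVec Z (fun i => A i j) j)
  convert this using 2 with α
  simp [Matrix.trace, Matrix.mul_apply, Matrix.mulVec, dotProduct]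

/-- The kernel map `K_Z : ℂ^{n×n} → F²_d` at a point `Z` of the ball. It is the linear map with
`K_Z (y v^*) = K{Z, y, v} = ∑_α ⟨Z^α v, y⟩ e_α`, see `kernelMap_vecMulVec`. -/
noncomputable def kernelMap {d n : ℕ} (Z : ncBall d n) :
    Matrix (Fin n) (Fin n) ℂ →ₗ[ℂ] Fock d where
  toFun A := ⟨fun α => ((wordPow Z.1 α)ᴴ * A).trace, memlp_kernel Z A⟩
  map_add' A B := by
    ext α
    exact (congrArg Matrix.trace (mul_add _ A B)).trans (Matrix.trace_add _ _)
  map_smul' c A := by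
    ext α
    exact (congrArg Matrix.trace (Matrix.mul_smul _ c A)).trans (Matrix.trace_smul _ _)

theorem kernelMap_vecMulVec {d n : ℕ} (Z : ncBall d n) (y v : EuclideanSpace ℂ (Fin n))
    (α : FreeMonoid (Fin d)) :
    kernelMap Z (Matrix.vecMulVec y (star v.ofLp)) α =
      inner ℂ (WithLp.toLp 2 (wordPow Z.1 α *ᵥ v.ofLp)) y := by
  change ((wordPow Z.1 α)ᴴ * Matrix.vecMulVec y (star v.ofLp)).trace = _
  rw [EuclideanSpace.inner_eq_star_dotProduct, Matrix.mul_vecMulVec, Matrix.trace_vecMulVec,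
    Matrix.star_mulVec, dotProduct_comm y.ofLp, ← Matrix.dotProduct_mulVec,
    dotProduct_comm]

theorem summable_eval {d n : ℕ} (x : Fock d) (Z : ncBall d n) (i j : Fin n) :
    Summable fun α : FreeMonoid (Fin d) => x α * wordPow Z.1 α i j := by
  have := lp.summable_inner (𝕜 := ℂ) (kernelMap Z (Matrix.single i j 1)) x
  refine this.congr fun α => ?_
  have h : kernelMap Z (Matrix.single i j 1) α = star (wordPow Z.1 α i j) := by
    change ((wordPow Z.1 α)ᴴ * Matrix.single i j 1).trace = _
    simp [Matrix.trace_mul_single]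
  rw [h]
  simp

/-- `T` acts as right multiplication by the free function `H`: `(T x)(Z) = x(Z) H(Z)` for every
`x ∈ dom T` and every point `Z` of the ball. -/
def ActsAsRightMul {d : ℕ} (T : Fock d →ₗ.[ℂ] Fock d) (H : FreeFunction d) : Prop :=
  ∀ (x : T.domain) (n : ℕ) (Z : ncBall d n), eval (T x) Z = eval (x : Fock d) Z * H.toFun Z

end FreeHardy

namespace FreeHardy

open scoped Matrix InnerProductSpace

/-! Passing to adjoints turns the affiliation of `T` into the statement that `T^*` commutes with the
backward shifts `L_k^*`, and these act on kernels by `L_k^* K_Z A = K_Z (Z_k^* A)`. Stripping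
letters one at a time, the coefficient of `T^* K_Z A` at `α` is that of `T^* K_Z ((Z^α)^* A)` at the
empty word. So `T^* K_Z` is determined by one linear functional on matrices, `A ↦ tr (A C)`, and
`T^* K_Z A = K_Z (A C)` (`adjointKernel_eq`). The symbol is `T(Z) = C^*`.

The reproducing property `⟪K_Z A, x⟫ = tr (A^* x(Z))` then turns this identity into `(T x)(Z) = x(Z)
T(Z)`. The symbol is a free function because kernels at intertwined points share vectors
(`kernelMap_mul_conjTranspose`), on which `T^*` has a single value. -/

/-- The adjoint of the left creation operator: it strips a leading letter `k`. -/
def leftAnnihilation {d : ℕ} (k : Fin d) (g : Fock d) : Fock d :=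
  ⟨fun α => g (FreeMonoid.of k * α), by
    have hg : Summable fun β : FreeMonoid (Fin d) => ‖g β‖ ^ (2 : ENNReal).toReal :=
      (lp.memℓp g).summable (by norm_num)
    exact memℓp_gen (hg.comp_injective (i := fun α => FreeMonoid.of k * α)
      fun _ _ h => mul_left_cancel h)⟩

theorem leftAnnihilation_apply {d : ℕ} (k : Fin d) (g : Fock d) (α : FreeMonoid (Fin d)) :
    leftAnnihilation k g α = g (FreeMonoid.of k * α) := rfl

theorem leftCreation_of_mul {d : ℕ} (k : Fin d) (f : Fock d) (α : FreeMonoid (Fin d)) :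
    leftCreation k f (FreeMonoid.of k * α) = f α := by
  change shiftCoeff k f (FreeMonoid.of k * α).toList = f α
  simp [shiftCoeff]

theorem leftCreation_eq_zero {d : ℕ} (k : Fin d) (f : Fock d) {α : FreeMonoid (Fin d)}
    (hα : α ∉ Set.range fun β => FreeMonoid.of k * β) : leftCreation k f α = 0 := by
  change shiftCoeff k f α.toList = 0
  rcases h : α.toList with _ | ⟨j, β⟩
  · rfl
  · simp only [shiftCoeff]
    rw [if_neg]
    rintro rfl
    exact hα ⟨FreeMonoid.ofList β, FreeMonoid.toList.injective (by simp [h])⟩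

theorem inner_leftCreation {d : ℕ} (k : Fin d) (g f : Fock d) :
    ⟪g, leftCreation k f⟫_ℂ = ⟪leftAnnihilation k g, f⟫_ℂ := by
  rw [lp.inner_eq_tsum, lp.inner_eq_tsum]
  have hinj : Function.Injective fun β : FreeMonoid (Fin d) => FreeMonoid.of k * β :=
    fun _ _ h => mul_left_cancel h
  -- Only words with leading letter `k` contribute, so the sum is reindexed along `β ↦ kβ`.
  rw [← hinj.tsum_eq]
  · simp only [leftCreation_of_mul, leftAnnihilation_apply]
  · intro α hα
    by_contra h
    exact hα (by simp [leftCreation_eq_zero k f h])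

/-! ### Kernel maps: backward shifts, reproducing property, intertwinings -/

theorem kernelMap_apply {d n : ℕ} (Z : ncBall d n) (A : Matrix (Fin n) (Fin n) ℂ)
    (α : FreeMonoid (Fin d)) : kernelMap Z A α = ((wordPow Z.1 α)ᴴ * A).trace := rfl

theorem leftAnnihilation_kernelMap {d n : ℕ} (k : Fin d) (Z : ncBall d n)
    (A : Matrix (Fin n) (Fin n) ℂ) :
    leftAnnihilation k (kernelMap Z A) = kernelMap Z ((Z.1 k)ᴴ * A) := by
  ext α
  rw [leftAnnihilation_apply, kernelMap_apply, kernelMap_apply, wordPow_of_mul,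
    Matrix.conjTranspose_mul, Matrix.mul_assoc]

/-- Reproducing property of the kernel maps, entry by entry. -/
theorem inner_kernelMap_single {d n : ℕ} (Z : ncBall d n) (x : Fock d) (i j : Fin n) :
    ⟪kernelMap Z (Matrix.single i j 1), x⟫_ℂ = eval x Z i j := by
  rw [lp.inner_eq_tsum]
  refine tsum_congr fun α => ?_
  simp [kernelMap_apply, Matrix.trace_mul_single]

/-- Reproducing property of the kernel maps. -/
theorem inner_kernelMap {d n : ℕ} (Z : ncBall d n) (x : Fock d)
    (A : Matrix (Fin n) (Fin n) ℂ) :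
    ⟪kernelMap Z A, x⟫_ℂ = (Aᴴ * eval x Z).trace := by
  induction A using Matrix.induction_on' with
  | h_zero => simp
  | h_add A B hA hB =>
    rw [map_add, inner_add_left, hA, hB, Matrix.conjTranspose_add, Matrix.add_mul,
      Matrix.trace_add]
  | h_std_basis i j c =>
    rw [← mul_one c, ← smul_eq_mul, ← Matrix.smul_single, map_smul, inner_smul_left,
      inner_kernelMap_single, Matrix.conjTranspose_smul, Matrix.smul_mul, Matrix.trace_smul]
    simp [Matrix.trace_single_mul]

/-- Every linear functional on square matrices is of the form `A ↦ tr (A C)`. -/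
theorem exists_trace_mul_eq {n : ℕ} (φ : Matrix (Fin n) (Fin n) ℂ →ₗ[ℂ] ℂ) :
    ∃ C : Matrix (Fin n) (Fin n) ℂ, ∀ A, φ A = (A * C).trace := by
  -- The indices are swapped because `tr (E_ij C) = C_ji`.
  refine ⟨Matrix.of fun j i => φ (Matrix.single i j 1), fun A => ?_⟩
  induction A using Matrix.induction_on' with
  | h_zero => simp
  | h_add A B hA hB => rw [map_add, hA, hB, Matrix.add_mul, Matrix.trace_add]
  | h_std_basis i j c =>
    rw [← mul_one c, ← smul_eq_mul, ← Matrix.smul_single, map_smul, Matrix.smul_mul,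
      Matrix.trace_smul]
    simp [Matrix.trace_single_mul]

theorem wordPow_mul_of_intertwines {d n m : ℕ} {Z : Fin d → Matrix (Fin n) (Fin n) ℂ}
    {W : Fin d → Matrix (Fin m) (Fin m) ℂ} {X : Matrix (Fin n) (Fin m) ℂ}
    (h : ∀ k, Z k * X = X * W k) (α : FreeMonoid (Fin d)) :
    wordPow Z α * X = X * wordPow W α := by
  induction α using FreeMonoid.inductionOn' with
  | one => simp [wordPow]
  | of_mul k β ih =>
    rw [wordPow_of_mul, wordPow_of_mul, Matrix.mul_assoc, ih, ← Matrix.mul_assoc, h,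
      Matrix.mul_assoc]

/-- By cyclicity of the trace, `tr ((Z^α)^* B X^*) = tr ((Z^α X)^* B)`, and `Z^α X = X W^α`. -/
theorem kernelMap_mul_conjTranspose {d n m : ℕ} (Z : ncBall d n) (W : ncBall d m)
    {X : Matrix (Fin n) (Fin m) ℂ} (h : ∀ k, Z.1 k * X = X * W.1 k)
    (B : Matrix (Fin n) (Fin m) ℂ) :
    kernelMap Z (B * Xᴴ) = kernelMap W (Xᴴ * B) := by
  ext α
  rw [kernelMap_apply, kernelMap_apply, ← Matrix.mul_assoc, Matrix.trace_mul_comm,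
    ← Matrix.mul_assoc, ← Matrix.mul_assoc, ← Matrix.conjTranspose_mul,
    ← Matrix.conjTranspose_mul, wordPow_mul_of_intertwines h]

/-! ### The adjoint on kernels and the symbol -/

section adjoint

variable {d : ℕ} {T : Fock d →ₗ.[ℂ] Fock d}

/-- The adjoint of an operator affiliated to the right free shift commutes with the adjoints of
the left creation operators. -/
theorem IsRightAffiliated.adjoint_leftAnnihilation (hT : IsRightAffiliated T) (k : Fin d)
    (f g : T.adjoint.domain) (h : leftAnnihilation k (f : Fock d) = g) :
    T.adjoint g = leftAnnihilation k (T.adjoint f) := by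
  -- Density of `dom T` makes the adjoint value unique, so it suffices to move `L_k` across `T`
  -- inside the inner product with each `x ∈ dom T`.
  refine LinearPMap.adjoint_apply_eq hT.dense_domain g fun x => ?_
  obtain ⟨hx, hTx⟩ := hT.comm k x
  rw [← inner_leftCreation, ← h, ← inner_leftCreation, ← hTx]
  exact T.adjoint_isFormalAdjoint hT.dense_domain f ⟨_, hx⟩

/-- The composition `T^* K_Z`. -/
noncomputable def adjointKernel (hZ : ∀ (n : ℕ) (Z : ncBall d n) (A : Matrix (Fin n) (Fin n) ℂ),
    kernelMap Z A ∈ T.adjoint.domain) {n : ℕ} (Z : ncBall d n) :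
    Matrix (Fin n) (Fin n) ℂ →ₗ[ℂ] Fock d :=
  T.adjoint.toFun ∘ₗ (kernelMap Z).codRestrict T.adjoint.domain (hZ n Z)

variable (hZ : ∀ (n : ℕ) (Z : ncBall d n) (A : Matrix (Fin n) (Fin n) ℂ),
    kernelMap Z A ∈ T.adjoint.domain)

theorem adjointKernel_apply {n : ℕ} (Z : ncBall d n) (A : Matrix (Fin n) (Fin n) ℂ) :
    adjointKernel hZ Z A = T.adjoint ⟨kernelMap Z A, hZ n Z A⟩ := rfl

theorem IsRightAffiliated.adjointKernel_word (hT : IsRightAffiliated T) {n : ℕ} (Z : ncBall d n)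
    (α : FreeMonoid (Fin d)) (A : Matrix (Fin n) (Fin n) ℂ) :
    adjointKernel hZ Z A α = adjointKernel hZ Z ((wordPow Z.1 α)ᴴ * A) 1 := by
  -- Removing the leading letter `k` replaces `A` by `Z_k^* A`, so `A` has to vary.
  induction α using FreeMonoid.inductionOn' generalizing A with
  | one => simp [wordPow]
  | of_mul k β ih =>
    rw [wordPow_of_mul, Matrix.conjTranspose_mul, Matrix.mul_assoc, ← ih,
      ← leftAnnihilation_apply]
    exact congrArg (fun f : Fock d => f β) (hT.adjoint_leftAnnihilation k
      ⟨_, hZ n Z A⟩ ⟨_, hZ n Z ((Z.1 k)ᴴ * A)⟩ (leftAnnihilation_kernelMap k Z A)).symm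

theorem exists_trace_mul_eq_adjointKernel_one {n : ℕ} (Z : ncBall d n) :
    ∃ C : Matrix (Fin n) (Fin n) ℂ, ∀ A, adjointKernel hZ Z A 1 = (A * C).trace :=
  exists_trace_mul_eq
    { toFun := fun A => adjointKernel hZ Z A 1
      map_add' := fun A B => by rw [map_add]; rfl
      map_smul' := fun c A => by rw [map_smul]; rfl }

/-- The adjoint `T(Z)^*` of the value at `Z` of the symbol of `T`. -/
noncomputable def symbolAdjoint {n : ℕ} (Z : ncBall d n) : Matrix (Fin n) (Fin n) ℂ :=
  (exists_trace_mul_eq_adjointKernel_one hZ Z).choose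

theorem adjointKernel_one {n : ℕ} (Z : ncBall d n) (A : Matrix (Fin n) (Fin n) ℂ) :
    adjointKernel hZ Z A 1 = (A * symbolAdjoint hZ Z).trace :=
  (exists_trace_mul_eq_adjointKernel_one hZ Z).choose_spec A

/-- `T^* K_Z A = K_Z (A T(Z)^*)`. -/
theorem IsRightAffiliated.adjointKernel_eq (hT : IsRightAffiliated T) {n : ℕ} (Z : ncBall d n)
    (A : Matrix (Fin n) (Fin n) ℂ) :
    adjointKernel hZ Z A = kernelMap Z (A * symbolAdjoint hZ Z) := by
  ext α
  rw [hT.adjointKernel_word hZ, adjointKernel_one, kernelMap_apply, Matrix.mul_assoc]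

/-- Obtained by applying `T^*` to the common vector `K_Z (B X^*) = K_W (X^* B)` and comparing
coefficients at the empty word for every `B`. -/
theorem symbolAdjoint_intertwines {n m : ℕ} (Z : ncBall d n) (W : ncBall d m)
    {X : Matrix (Fin n) (Fin m) ℂ} (h : ∀ k, Z.1 k * X = X * W.1 k) :
    Xᴴ * symbolAdjoint hZ Z = symbolAdjoint hZ W * Xᴴ := by
  refine Matrix.ext_iff_trace_mul_left.2 fun B => ?_
  have hB : adjointKernel hZ Z (B * Xᴴ) = adjointKernel hZ W (Xᴴ * B) := by
    simp only [adjointKernel_apply, kernelMap_mul_conjTranspose Z W h]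
  have := congrArg (fun f : Fock d => f 1) hB
  simp only [adjointKernel_one] at this
  rw [← Matrix.mul_assoc, this, Matrix.mul_assoc, Matrix.trace_mul_comm, Matrix.mul_assoc]

/-- The symbol of an operator whose adjoint is defined on all kernels, as a free function. -/
noncomputable def symbol : FreeFunction d where
  toFun Z := (symbolAdjoint hZ Z)ᴴ
  intertwines Z W X h := by
    have := congrArg Matrix.conjTranspose (symbolAdjoint_intertwines hZ Z W h)
    simpa only [Matrix.conjTranspose_mul, Matrix.conjTranspose_conjTranspose] using this

theorem IsRightAffiliated.actsAsRightMul_symbol (hT : IsRightAffiliated T) :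
    ActsAsRightMul T (symbol hZ) := by
  intro x n Z
  refine Matrix.ext_iff_trace_mul_left.2 fun A => ?_
  -- The kernel is taken at `Aᴴ` since the reproducing formula conjugates its argument, which yields
  -- the trace against `A`.
  have h := T.adjoint_isFormalAdjoint hT.dense_domain ⟨_, hZ n Z Aᴴ⟩ x
  rw [← adjointKernel_apply, hT.adjointKernel_eq, inner_kernelMap, inner_kernelMap,
    Matrix.conjTranspose_mul, Matrix.conjTranspose_conjTranspose] at h
  rw [← h, Matrix.mul_assoc, Matrix.trace_mul_comm, Matrix.mul_assoc]
  rfl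

end adjoint

end FreeHardy

theorem corollary6p7 (d : ℕ) (T : FreeHardy.Fock d →ₗ.[ℂ] FreeHardy.Fock d)
    (hT : FreeHardy.IsRightAffiliated T)
    (hK : (⨆ (n : ℕ) (Z : FreeHardy.ncBall d n), LinearMap.range (FreeHardy.kernelMap Z)) ≤
      T.adjoint.domain) :
    ∃ H : FreeHardy.FreeFunction d, FreeHardy.ActsAsRightMul T H :=
  ⟨FreeHardy.symbol fun n Z A => hK (Submodule.mem_iSup_of_mem n
    (Submodule.mem_iSup_of_mem Z (LinearMap.mem_range_self _ A))),
    hT.actsAsRightMul_symbol _⟩
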